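/- Let $\mathbb{R}^n$ carry the Euclidean norm. Let $h:\mathbb{R}^n\to\mathbb{R}$ be differentiable with globally Lipschitz continuous gradient, with Lipschitz constant $L>0$, let $P:\mathbb{R}^n\to(-\infty,\infty]$ be proper, lower semicontinuous and convex, and put $f=h+P$. For a proper function $g:\mathbb{R}^n\to(-\infty,\infty]$ and $x$ with $g(x)<\infty$ let $$\widehat\partial g(x)=\Big\{v:\ \liminf_{z\to x,\,z\ne x}\frac{g(z)-g(x)-\langle v,z-x\rangle}{\|z-x\|}\ge 0\Big\},$$ and let $\partial g(x)$ be the set of all limits $v=\lim_t v^t$ with $v^t\in\widehat\partial g(x^t)$, $x^t\to x$ and $g(x^t)\to g(x)$; both sets are empty if $g(x)=\infty$. A point $x$ is a stationary point of $g$ if $0\in\partial g(x)$. The function $g$ is a KL function with exponent $\frac12$ if for every $\bar x$ with $\partial g(\bar x)\neq\emptyset$ there are $c,\epsilon>0$ and $\nu\in(0,\infty]$ such that $$\operatorname{dist}(0,\partial g(x))\ \ge\ c\,(g(x)-g(\bar x))^{1/2}\quad\text{whenever } \|x-\bar x\|\le\epsilon \text{ and } g(\bar x)<g(x)<g(\bar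 x)+\nu,$$ where the distance to the empty set is $+\infty$. Suppose that $f$ is coercive, i.e. $f(x)\to\infty$ as $\|x\|\to\infty$, and that $f$ is a KL function with exponent $\frac12$. Let $\beta\in[0,1)$ and $\alpha\in\big(0,\frac{2(1-\beta)}{L}\big)$. Let $x^0\in\mathbb{R}^n$ be arbitrary, put $x^{-1}=x^0$, and let $\{x^k\}$ be generated by iPiano with these constant parameters, that is, for all $k\ge 0$, $$x^{k+1}=\operatorname*{arg\,min}_{x\in\mathbb{R}^n}\Big\{\Big\langle\nabla h(x^k)-\frac{\beta}{\alpha}(x^k-x^{k-1}),\,x-x^k\Big\rangle+\frac1{2\alpha}\|x-x^k\|^2+P(x)\Big\}.$$ Then there is a stationary point $\bar x$ of $f$ such that $x^k\to\bar x$ and $\{x^k\}$ converges to $\bar x$ $R$-linearly, i.e. $\limsup_{k\to\infty}\|x^k-\bar x\|^{1/k}<1$. -/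

import Mathlib

open Filter Topology Set
open scoped Gradient

/-- Extended-real-valued `f` is proper: it never takes the value `-∞` and its domain
`{x | f x < ∞}` is nonempty. -/
def ProperFun {n : ℕ} (f : EuclideanSpace ℝ (Fin n) → EReal) : Prop :=
  (∀ x, f x ≠ ⊥) ∧ ∃ x, f x < ⊤

/-- Convexity of an extended-real-valued function: its epigraph is a convex set. -/
def ConvexFun {n : ℕ} (f : EuclideanSpace ℝ (Fin n) → EReal) : Prop :=
  Convex ℝ {p : EuclideanSpace ℝ (Fin n) × ℝ | f p.1 ≤ (p.2 : EReal)}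

/-- Coercivity: `f x → ∞` as `‖x‖ → ∞`. -/
def CoerciveFun {n : ℕ} (f : EuclideanSpace ℝ (Fin n) → EReal) : Prop :=
  Tendsto f (Bornology.cobounded (EuclideanSpace ℝ (Fin n))) (𝓝 ⊤)

/-- The regular subdifferential of a proper function `f` at `x`; it is empty outside `dom f`. -/
noncomputable def regularSubdifferential {n : ℕ} (f : EuclideanSpace ℝ (Fin n) → EReal)
    (x : EuclideanSpace ℝ (Fin n)) : Set (EuclideanSpace ℝ (Fin n)) :=
  {v | f x < ⊤ ∧
    0 ≤ liminf (fun z => (f z - f x - ((inner ℝ v (z - x) : ℝ) : EReal)) / ((‖z - x‖ : ℝ) : EReal))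
      (𝓝[≠] x)}

/-- The limiting subdifferential of a proper function `f` at `x`; it is empty outside `dom f`. -/
noncomputable def limitingSubdifferential {n : ℕ} (f : EuclideanSpace ℝ (Fin n) → EReal)
    (x : EuclideanSpace ℝ (Fin n)) : Set (EuclideanSpace ℝ (Fin n)) :=
  {v | f x < ⊤ ∧ ∃ (y w : ℕ → EuclideanSpace ℝ (Fin n)),
    Tendsto y atTop (𝓝 x) ∧ Tendsto (fun t => f (y t)) atTop (𝓝 (f x)) ∧
    Tendsto w atTop (𝓝 v) ∧ ∀ t, w t ∈ regularSubdifferential f (y t)}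

/-- `x` is a stationary point of `f`. -/
def IsStationaryPoint {n : ℕ} (f : EuclideanSpace ℝ (Fin n) → EReal)
    (x : EuclideanSpace ℝ (Fin n)) : Prop :=
  0 ∈ limitingSubdifferential f x

/-- `f` has the KL property at `a` with exponent `θ`. The distance to the empty set is `∞`
(the value of `Metric.infEDist`), and in the conclusion `f x` and `f a` are finite, so that
`EReal.toReal` is the honest value of their difference. -/
def HasKLExponentAt {n : ℕ} (f : EuclideanSpace ℝ (Fin n) → EReal) (θ : ℝ)
    (a : EuclideanSpace ℝ (Fin n)) : Prop :=
  ∃ c > (0 : ℝ), ∃ ε > (0 : ℝ), ∃ ν > (0 : EReal), ∀ x,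
    ‖x - a‖ ≤ ε → f a < f x → f x < f a + ν →
      ENNReal.ofReal (c * (f x - f a).toReal ^ θ) ≤
        Metric.infEDist 0 (limitingSubdifferential f x)

/-- `f` is a KL function with exponent `θ`: it has the KL property with exponent `θ` at every
point where the limiting subdifferential is nonempty. -/
def IsKLFunctionWithExponent {n : ℕ} (f : EuclideanSpace ℝ (Fin n) → EReal) (θ : ℝ) : Prop :=
  ∀ a, (limitingSubdifferential f a).Nonempty → HasKLExponentAt f θ a

/-- The objective of the iPiano subproblem with step-size `α` and inertial parameter `β`, where
`cur` is the current and `prev` the previous iterate. -/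
noncomputable def iPianoObjective {n : ℕ} (h : EuclideanSpace ℝ (Fin n) → ℝ)
    (P : EuclideanSpace ℝ (Fin n) → EReal) (α β : ℝ) (prev cur : EuclideanSpace ℝ (Fin n))
    (y : EuclideanSpace ℝ (Fin n)) : EReal :=
  ((inner ℝ (∇ h cur - (β / α) • (cur - prev)) (y - cur) + 1 / (2 * α) * ‖y - cur‖ ^ 2 : ℝ) : EReal)
    + P y

/-- `x⁰, x¹, …` is generated by iPiano with constant step-size `α` and inertial parameter `β`.
The initial step uses `x⁻¹ = x⁰`; the point `x⁰` is arbitrary. -/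
def IsIPianoSequence {n : ℕ} (h : EuclideanSpace ℝ (Fin n) → ℝ)
    (P : EuclideanSpace ℝ (Fin n) → EReal) (α β : ℝ) (x : ℕ → EuclideanSpace ℝ (Fin n)) : Prop :=
  IsMinOn (iPianoObjective h P α β (x 0) (x 0)) univ (x 1) ∧
    ∀ k, IsMinOn (iPianoObjective h P α β (x k) (x (k + 1))) univ (x (k + 2))

/-- `x` converges R-linearly to `a`: `x k → a` and `limsup ‖x k - a‖ ^ (1 / k) < 1`. -/
def ConvergesRLinearly {n : ℕ} (x : ℕ → EuclideanSpace ℝ (Fin n))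
    (a : EuclideanSpace ℝ (Fin n)) : Prop :=
  Tendsto x atTop (𝓝 a) ∧
    limsup (fun k : ℕ => ((‖x k - a‖ ^ (1 / (k : ℝ)) : ℝ) : EReal)) atTop < 1

/-! ### Descent lemma and geometric convergence of real sequences. -/

section RealAnalysis

/-! Inertia may make `f = h + P` increase along the iterates, but `f` plus a multiple of the last
squared step decreases, by at least a multiple of the two latest squared steps. This combines the
descent lemma for `h` with the subgradient inequality for `P`; the bound on `α` makes the multiple
positive. By coercivity the iterates are bounded, so this Lyapunov value converges to some `s` and
the steps vanish. Closedness of the convex subdifferential then makes every cluster point stationary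
with value `s`.

Optimality in the subproblem yields a subgradient of `f` at each new iterate, bounded by the two
latest steps. The KL inequality with exponent 1/2, made uniform by compactness, bounds `f - s` by
its squared norm, hence by the Lyapunov decrease. The Lyapunov gap therefore contracts by a fixed
factor, and the steps, controlled by its square root, are dominated by a geometric series. -/

/-- A function with `L`-Lipschitz gradient lies below its quadratic upper model. -/
lemma le_quadratic_model_of_lipschitz_gradient {E : Type*} [NormedAddCommGroup E]
    [InnerProductSpace ℝ E] [CompleteSpace E] {h : E → ℝ} {L : ℝ} (hdiff : Differentiable ℝ h)
    (hLip : ∀ x y, ‖∇ h x - ∇ h y‖ ≤ L * ‖x - y‖) (x z : E) :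
    h z ≤ h x + inner ℝ (∇ h x) (z - x) + L / 2 * ‖z - x‖ ^ 2 := by
  set d := z - x with hd
  let φ : ℝ → ℝ := fun t => h (x + t • d) - t * inner ℝ (∇ h x) d - L / 2 * t ^ 2 * ‖d‖ ^ 2
  have hφ : ∀ t, HasDerivAt φ (inner ℝ (∇ h (x + t • d)) d - inner ℝ (∇ h x) d
      - L * t * ‖d‖ ^ 2) t := by
    intro t
    have h1 : HasDerivAt (fun t : ℝ => x + t • d) d t := by
      simpa using ((hasDerivAt_id t).smul_const d).const_add x
    have h2 := (hdiff (x + t • d)).hasGradientAt.hasFDerivAt.comp_hasDerivAt t h1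
    have h3 := (h2.sub ((hasDerivAt_id t).mul_const (inner ℝ (∇ h x) d))).sub
      ((((hasDerivAt_id t).pow 2).const_mul (L / 2)).mul_const (‖d‖ ^ 2))
    refine h3.congr_deriv ?_
    simp only [InnerProductSpace.toDual_apply_apply, id_eq, Nat.cast_ofNat]
    ring
  have hanti : AntitoneOn φ (Icc 0 1) := by
    refine antitoneOn_of_deriv_nonpos (convex_Icc 0 1)
      (fun t _ => (hφ t).continuousAt.continuousWithinAt)
      (fun t _ => (hφ t).differentiableAt.differentiableWithinAt) fun t ht => ?_
    rw [interior_Icc] at ht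
    rw [(hφ t).deriv, ← inner_sub_left]
    have h1 := real_inner_le_norm (∇ h (x + t • d) - ∇ h x) d
    have h2 := hLip (x + t • d) x
    rw [add_sub_cancel_left, norm_smul, Real.norm_of_nonneg ht.1.le] at h2
    nlinarith [mul_le_mul_of_nonneg_right h2 (norm_nonneg d)]
  have := hanti (left_mem_Icc.2 zero_le_one) (right_mem_Icc.2 zero_le_one) zero_le_one
  simp only [φ, hd, one_smul, add_sub_cancel, zero_smul, add_zero, one_mul, zero_mul, one_pow,
    mul_one, ne_eq, OfNat.ofNat_ne_zero, not_false_eq_true, zero_pow, mul_zero, sub_zero] at this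
  linarith

/-- A sequence bounded by a geometric one has root-limsup smaller than one. -/
lemma limsup_rpow_inv_lt_one {u : ℕ → ℝ} {C r : ℝ} (hu : ∀ k, 0 ≤ u k) (hr0 : 0 < r) (hr1 : r < 1)
    (hC : 0 < C) (h : ∀ᶠ k in atTop, u k ≤ C * r ^ k) :
    limsup (fun k : ℕ => ((u k ^ (1 / (k : ℝ)) : ℝ) : EReal)) atTop < 1 := by
  have hlim : Tendsto (fun k : ℕ => C ^ (1 / (k : ℝ)) * r) atTop (𝓝 r) := by
    have h0 : Tendsto (fun k : ℕ => 1 / (k : ℝ)) atTop (𝓝 0) := tendsto_one_div_atTop_nhds_zero_nat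
    have := ((Real.continuous_const_rpow hC.ne').tendsto 0).comp h0
    simpa using this.mul_const r
  obtain ⟨s, hrs, hs1⟩ := exists_between hr1
  have hev : ∀ᶠ k : ℕ in atTop, ((u k ^ (1 / (k : ℝ)) : ℝ) : EReal) ≤ (s : EReal) := by
    filter_upwards [h, hlim.eventually_lt_const hrs, eventually_gt_atTop 0] with k hk hks hk0
    rw [EReal.coe_le_coe_iff]
    refine le_trans ?_ hks.le
    have hk0' : (k : ℝ) ≠ 0 := by positivity
    calc u k ^ (1 / (k : ℝ)) ≤ (C * r ^ k) ^ (1 / (k : ℝ)) :=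
          Real.rpow_le_rpow (hu k) hk (by positivity)
      _ = C ^ (1 / (k : ℝ)) * r := by
          rw [Real.mul_rpow hC.le (by positivity), ← Real.rpow_natCast r k,
            ← Real.rpow_mul hr0.le, mul_one_div_cancel hk0', Real.rpow_one]
  exact (limsup_le_of_le (by isBoundedDefault) hev).trans_lt (by exact_mod_cast hs1)

/-- If the errors `e k` decrease sufficiently and satisfy an error bound, then the sequence
converges with a geometric rate. -/
lemma exists_geometric_rate {E : Type*} [NormedAddCommGroup E] [CompleteSpace E] {y : ℕ → E}
    {e : ℕ → ℝ} {η M : ℝ} (hη : 0 < η) (hM : 0 < M) (he : ∀ k, 0 ≤ e k)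
    (hdec : ∀ k, η * ‖y (k + 1) - y k‖ ^ 2 ≤ e k - e (k + 1))
    (hbound : ∀ᶠ k in atTop, e (k + 1) ≤ M * (e k - e (k + 1))) :
    ∃ a, Tendsto y atTop (𝓝 a) ∧ ∃ C > 0, ∃ r > 0, r < 1 ∧ ∀ᶠ k in atTop, ‖y k - a‖ ≤ C * r ^ k := by
  obtain ⟨N, hN⟩ := eventually_atTop.1 hbound
  -- Solving `e (k+1) ≤ M * (e k - e (k+1))` for `e (k+1)` gives this factor.
  set q := M / (1 + M) with hq
  have hq0 : 0 < q := by positivity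
  have hq1 : q < 1 := by rw [hq, div_lt_one (by positivity)]; linarith
  have hstep : ∀ k ≥ N, e (k + 1) ≤ q * e k := by
    intro k hk
    rw [hq, div_mul_eq_mul_div, le_div_iff₀ (by positivity)]
    linarith [hN k hk]
  have hgeo : ∀ k, e (N + k) ≤ e N * q ^ k := by
    intro k
    induction k with
    | zero => simp
    | succ k ih =>
      calc e (N + (k + 1)) ≤ q * e (N + k) := hstep (N + k) (by omega)
        _ ≤ q * (e N * q ^ k) := by gcongr
        _ = e N * q ^ (k + 1) := by ring
  set r := √q with hr
  have hr0 : 0 < r := Real.sqrt_pos.2 hq0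
  have hr1 : r < 1 := by rw [hr, Real.sqrt_lt' one_pos]; simpa using hq1
  have hdist : ∀ k, dist (y (N + k)) (y (N + (k + 1))) ≤ √(e N / η) * r ^ k := by
    intro k
    rw [dist_comm, dist_eq_norm]
    refine le_of_sq_le_sq ?_ (by positivity)
    rw [mul_pow, Real.sq_sqrt (div_nonneg (he N) hη.le), ← pow_mul, mul_comm k 2, pow_mul, hr,
      Real.sq_sqrt hq0.le, div_mul_eq_mul_div, le_div_iff₀ hη]
    have h1 := hdec (N + k)
    rw [add_assoc] at h1
    linarith [hgeo k, he (N + (k + 1))]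
  obtain ⟨a, ha⟩ := cauchySeq_tendsto_of_complete
    (cauchySeq_of_le_geometric r _ hr1 hdist)
  refine ⟨a, (tendsto_add_atTop_iff_nat N).1 (by simpa only [add_comm] using ha),
    -- The `+ 1` keeps the constant positive when `e N = 0`; `r ^ N` undoes the shift.
    (√(e N / η) / (1 - r) + 1) / r ^ N, ?_, r, hr0, hr1, ?_⟩
  · have := sub_pos.2 hr1
    positivity
  · filter_upwards [eventually_ge_atTop N] with k hk
    obtain ⟨j, rfl⟩ := Nat.exists_eq_add_of_le hk
    have := dist_le_of_le_geometric_of_tendsto r _ hr1 hdist ha j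
    rw [dist_eq_norm] at this
    refine this.trans ?_
    have h1 : 0 < r ^ j := by positivity
    have h2 : (√(e N / η) / (1 - r) + 1) / r ^ N * r ^ (N + j)
        = (√(e N / η) / (1 - r) + 1) * r ^ j := by
      rw [pow_add]; field_simp
    rw [h2, mul_div_right_comm]
    gcongr
    linarith

end RealAnalysis

/-! ### Convex subgradients and their relation to the limiting subdifferential. -/

section Subgradients

variable {n : ℕ}

/-- `w` is a subgradient of the extended-real-valued function `P` at `y`, in the sense of convex
analysis. -/
def IsConvexSubgradient (P : EuclideanSpace ℝ (Fin n) → EReal)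
    (y w : EuclideanSpace ℝ (Fin n)) : Prop :=
  ∀ z, P y + ((inner ℝ w (z - y) : ℝ) : EReal) ≤ P z

lemma ConvexFun.le_toReal {P : EuclideanSpace ℝ (Fin n) → EReal} (hconv : ConvexFun P)
    {y z : EuclideanSpace ℝ (Fin n)} {p q t : ℝ} (hy : P y ≤ p) (hz : P z ≤ q)
    (ht0 : 0 ≤ t) (ht1 : t ≤ 1) :
    P (y + t • (z - y)) ≤ ((p + t * (q - p) : ℝ) : EReal) := by
  have h1 : ((y, p) : EuclideanSpace ℝ (Fin n) × ℝ) ∈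
      {p : EuclideanSpace ℝ (Fin n) × ℝ | P p.1 ≤ (p.2 : EReal)} := hy
  have h2 : ((z, q) : EuclideanSpace ℝ (Fin n) × ℝ) ∈
      {p : EuclideanSpace ℝ (Fin n) × ℝ | P p.1 ≤ (p.2 : EReal)} := hz
  simpa using hconv.add_smul_sub_mem h1 h2 ⟨ht0, ht1⟩

lemma iPianoObjective_minimizer_ne_top {h : EuclideanSpace ℝ (Fin n) → ℝ}
    {P : EuclideanSpace ℝ (Fin n) → EReal} {α β : ℝ} (hP : ProperFun P)
    {prev cur y : EuclideanSpace ℝ (Fin n)}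
    (hmin : IsMinOn (iPianoObjective h P α β prev cur) univ y) : P y ≠ ⊤ := by
  obtain ⟨z, hz⟩ := hP.2
  intro htop
  have := isMinOn_univ_iff.1 hmin z
  rw [iPianoObjective, htop, EReal.coe_add_top, top_le_iff] at this
  exact (EReal.add_lt_top (EReal.coe_ne_top _) hz.ne).ne this

/-- First-order optimality in the iPiano subproblem. -/
lemma iPianoObjective_minimizer_subgradient {h : EuclideanSpace ℝ (Fin n) → ℝ}
    {P : EuclideanSpace ℝ (Fin n) → EReal} {α β : ℝ} (hP : ProperFun P) (hconv : ConvexFun P)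
    {prev cur y : EuclideanSpace ℝ (Fin n)}
    (hmin : IsMinOn (iPianoObjective h P α β prev cur) univ y) :
    IsConvexSubgradient P y
      (-(∇ h cur - (β / α) • (cur - prev) + (1 / α) • (y - cur))) := by
  intro z
  by_cases hz : P z = ⊤
  · rw [hz]; exact le_top
  have hy := iPianoObjective_minimizer_ne_top hP hmin
  obtain ⟨p, hp⟩ : ∃ p : ℝ, P y = p := ⟨_, (EReal.coe_toReal hy (hP.1 y)).symm⟩
  obtain ⟨q, hq⟩ : ∃ q : ℝ, P z = q := ⟨_, (EReal.coe_toReal hz (hP.1 z)).symm⟩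
  set v := ∇ h cur - (β / α) • (cur - prev) with hv
  -- Compare `y` with a point on the segment towards `z`, divide by `t`, then let `t → 0`.
  have key : ∀ t ∈ Ioo (0 : ℝ) 1,
      0 ≤ inner ℝ v (z - y) + 1 / α * inner ℝ (y - cur) (z - y)
        + 1 / (2 * α) * t * ‖z - y‖ ^ 2 + (q - p) := by
    intro t ht
    have h1 := (isMinOn_univ_iff.1 hmin (y + t • (z - y))).trans
      (add_le_add_right (hconv.le_toReal hp.le hq.le ht.1.le ht.2.le) _)
    rw [iPianoObjective, hp, ← EReal.coe_add, ← EReal.coe_add, EReal.coe_le_coe_iff, ← hv,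
      show y + t • (z - y) - cur = (y - cur) + t • (z - y) by abel, norm_add_sq_real,
      inner_add_right, inner_smul_right, inner_smul_right, norm_smul,
      Real.norm_of_nonneg ht.1.le] at h1
    have h2 : 0 ≤ t * (inner ℝ v (z - y) + 1 / α * inner ℝ (y - cur) (z - y)
        + 1 / (2 * α) * t * ‖z - y‖ ^ 2 + (q - p)) := by
      have h3 : 1 / α = 2 * (1 / (2 * α)) := by
        rw [one_div, one_div, mul_inv, ← mul_assoc]; norm_num
      rw [h3]
      linarith
    exact nonneg_of_mul_nonneg_right h2 ht.1
  have hlim : Tendsto (fun t : ℝ => inner ℝ v (z - y) + 1 / α * inner ℝ (y - cur) (z - y)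
        + 1 / (2 * α) * t * ‖z - y‖ ^ 2 + (q - p)) (𝓝[>] 0)
      (𝓝 (inner ℝ v (z - y) + 1 / α * inner ℝ (y - cur) (z - y)
        + 1 / (2 * α) * 0 * ‖z - y‖ ^ 2 + (q - p))) := by
    apply tendsto_nhdsWithin_of_tendsto_nhds
    apply Continuous.tendsto
    fun_prop
  have h0 := ge_of_tendsto hlim
    (by filter_upwards [Ioo_mem_nhdsGT (one_pos : (0 : ℝ) < 1)] with t ht using key t ht)
  rw [hp, hq, ← EReal.coe_add, EReal.coe_le_coe_iff, inner_neg_left, inner_add_left,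
    real_inner_smul_left]
  linarith

/-- A convex subgradient of `P` yields a regular subgradient of `h + P`. -/
lemma IsConvexSubgradient.mem_regularSubdifferential {h : EuclideanSpace ℝ (Fin n) → ℝ}
    {P : EuclideanSpace ℝ (Fin n) → EReal} {y w : EuclideanSpace ℝ (Fin n)}
    (hw : IsConvexSubgradient P y w) (hh : DifferentiableAt ℝ h y) (hbot : ∀ z, P z ≠ ⊥)
    (htop : P y ≠ ⊤) :
    ∇ h y + w ∈ regularSubdifferential (fun x => (h x : EReal) + P x) y := by
  obtain ⟨p, hp⟩ : ∃ p : ℝ, P y = p := ⟨_, (EReal.coe_toReal htop (hbot y)).symm⟩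
  refine ⟨EReal.add_lt_top (EReal.coe_ne_top _) htop, ?_⟩
  refine EReal.ge_of_forall_gt_iff_ge.1 fun c hc => ?_
  have hc' : c < 0 := by exact_mod_cast hc
  have hlo := hasGradientAt_iff_isLittleO.1 hh.hasGradientAt
  refine le_liminf_of_le (by isBoundedDefault) ?_
  filter_upwards [nhdsWithin_le_nhds (hlo.def (neg_pos.2 hc')), self_mem_nhdsWithin] with z hz hne
  have hpos : 0 < ‖z - y‖ := norm_pos_iff.2 (sub_ne_zero.2 hne)
  rw [EReal.le_div_iff_mul_le (by exact_mod_cast hpos) (EReal.coe_ne_top _)]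
  by_cases hzt : P z = ⊤
  · rw [hzt, hp, EReal.coe_add_top, ← EReal.coe_add, EReal.top_sub_coe, EReal.top_sub_coe]
    exact le_top
  obtain ⟨q, hq⟩ : ∃ q : ℝ, P z = q := ⟨_, (EReal.coe_toReal hzt (hbot z)).symm⟩
  have hwz := hw z
  rw [hp, hq, ← EReal.coe_add, EReal.coe_le_coe_iff] at hwz
  rw [hp, hq, ← EReal.coe_add, ← EReal.coe_add, ← EReal.coe_sub, ← EReal.coe_sub, ← EReal.coe_mul,
    EReal.coe_le_coe_iff, inner_add_left]
  have := neg_le_of_abs_le hz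
  linarith

lemma regularSubdifferential_subset_limitingSubdifferential
    (f : EuclideanSpace ℝ (Fin n) → EReal) (x : EuclideanSpace ℝ (Fin n)) :
    regularSubdifferential f x ⊆ limitingSubdifferential f x := fun v hv =>
  ⟨hv.1, fun _ => x, fun _ => v, tendsto_const_nhds, tendsto_const_nhds, tendsto_const_nhds,
    fun _ => hv⟩

/-- The graph of the convex subdifferential of a lower semicontinuous function is closed, and
function values converge along it. -/
lemma IsConvexSubgradient.of_tendsto {P : EuclideanSpace ℝ (Fin n) → EReal}
    (hlsc : LowerSemicontinuous P) {y w : ℕ → EuclideanSpace ℝ (Fin n)} {p : ℕ → ℝ}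
    {a v : EuclideanSpace ℝ (Fin n)} {s : ℝ} (hp : ∀ k, P (y k) = p k)
    (hw : ∀ k, IsConvexSubgradient P (y k) (w k)) (hy : Tendsto y atTop (𝓝 a))
    (hwv : Tendsto w atTop (𝓝 v)) (hps : Tendsto p atTop (𝓝 s)) :
    P a = s ∧ IsConvexSubgradient P a v := by
  -- The affine minorants pass to the limit. At `z = a` this gives `s ≤ P a`; lower semicontinuity
  -- gives the converse.
  have hle : ∀ z, ((s + inner ℝ v (z - a) : ℝ) : EReal) ≤ P z := by
    intro z
    have hlim : Tendsto (fun k => ((p k + inner ℝ (w k) (z - y k) : ℝ) : EReal)) atTop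
        (𝓝 ((s + inner ℝ v (z - a) : ℝ) : EReal)) :=
      (continuous_coe_real_ereal.tendsto _).comp
        (hps.add (hwv.inner (tendsto_const_nhds.sub hy)))
    refine le_of_tendsto' hlim fun k => ?_
    rw [EReal.coe_add, ← hp k]
    exact hw k z
  have hge : P a ≤ s := by
    by_contra! hlt
    obtain ⟨c, hsc, hca⟩ := EReal.lt_iff_exists_real_btwn.1 hlt
    have h1 : ∀ᶠ k in atTop, (c : EReal) < P (y k) := hy.eventually (hlsc a c hca)
    have h2 : ∀ᶠ k in atTop, p k < c := hps.eventually_lt_const (by exact_mod_cast hsc)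
    obtain ⟨k, hk1, hk2⟩ := (h1.and h2).exists
    rw [hp k, EReal.coe_lt_coe_iff] at hk1
    exact lt_asymm hk1 hk2
  have heq : P a = s := le_antisymm hge (by simpa using hle a)
  exact ⟨heq, fun z => by rw [heq, ← EReal.coe_add]; exact hle z⟩

end Subgradients

/-! ### One-step estimates and the uniform KL bound. -/

section Estimates

variable {n : ℕ}

/-- Decrease of `h + P` along one iPiano step. -/
lemma iPiano_step_le {h : EuclideanSpace ℝ (Fin n) → ℝ} {P : EuclideanSpace ℝ (Fin n) → EReal}
    {L α β p q : ℝ} (hdiff : Differentiable ℝ h) (hLip : ∀ x y, ‖∇ h x - ∇ h y‖ ≤ L * ‖x - y‖)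
    (hα : 0 < α) (hβ : 0 ≤ β) {prev cur y : EuclideanSpace ℝ (Fin n)} (hcur : P cur = p)
    (hy : P y = q)
    (hw : IsConvexSubgradient P y
      (-(∇ h cur - (β / α) • (cur - prev) + (1 / α) • (y - cur)))) :
    h y + q ≤ h cur + p + β / (2 * α) * ‖cur - prev‖ ^ 2
      - (1 / α - L / 2 - β / (2 * α)) * ‖y - cur‖ ^ 2 := by
  -- Testing the subgradient at `cur` gains `1 / α`, where comparing objective values would gain
  -- only `1 / (2 * α)`.
  have h1 := hw cur
  rw [hcur, hy, ← EReal.coe_add, EReal.coe_le_coe_iff, ← neg_sub y cur, inner_neg_neg,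
    inner_add_left, inner_sub_left, real_inner_smul_left, real_inner_smul_left,
    real_inner_self_eq_norm_sq] at h1
  have h2 := le_quadratic_model_of_lipschitz_gradient hdiff hLip cur y
  have h3 : inner ℝ (cur - prev) (y - cur) ≤ (‖cur - prev‖ ^ 2 + ‖y - cur‖ ^ 2) / 2 := by
    nlinarith [real_inner_le_norm (cur - prev) (y - cur),
      sq_nonneg (‖cur - prev‖ - ‖y - cur‖)]
  have h4 := mul_le_mul_of_nonneg_left h3 (div_nonneg hβ hα.le)
  have h5 : β / (2 * α) = β / α / 2 := by field_simp
  rw [h5]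
  linarith

/-- Bound on the subgradient of `h + P` at the new iterate of an iPiano step. -/
lemma iPiano_subgradient_norm_sq_le {h : EuclideanSpace ℝ (Fin n) → ℝ} {L α β : ℝ}
    (hL : 0 ≤ L) (hLip : ∀ x y, ‖∇ h x - ∇ h y‖ ≤ L * ‖x - y‖) (hα : 0 < α) (hβ : 0 ≤ β)
    (prev cur y : EuclideanSpace ℝ (Fin n)) :
    ‖∇ h y + -(∇ h cur - (β / α) • (cur - prev) + (1 / α) • (y - cur))‖ ^ 2 ≤
      2 * (L + β / α + 1 / α) ^ 2 * (‖cur - prev‖ ^ 2 + ‖y - cur‖ ^ 2) := by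
  have hβα : 0 ≤ β / α := div_nonneg hβ hα.le
  have hα' : 0 ≤ 1 / α := by positivity
  have h1 : ‖∇ h y + -(∇ h cur - (β / α) • (cur - prev) + (1 / α) • (y - cur))‖ ≤
      (L + β / α + 1 / α) * (‖cur - prev‖ + ‖y - cur‖) := by
    calc _ = ‖(∇ h y - ∇ h cur) + (β / α) • (cur - prev) - (1 / α) • (y - cur)‖ := by
          congr 1; abel
      _ ≤ ‖∇ h y - ∇ h cur‖ + ‖(β / α) • (cur - prev)‖ + ‖(1 / α) • (y - cur)‖ :=
          (norm_sub_le _ _).trans (by gcongr; exact norm_add_le _ _)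
      _ ≤ L * ‖y - cur‖ + β / α * ‖cur - prev‖ + 1 / α * ‖y - cur‖ := by
          rw [norm_smul, norm_smul, Real.norm_of_nonneg hβα, Real.norm_of_nonneg hα']
          gcongr
          exact hLip y cur
      _ ≤ _ := by
          nlinarith [mul_nonneg hL (norm_nonneg (cur - prev)),
            mul_nonneg hβα (norm_nonneg (y - cur)), mul_nonneg hα' (norm_nonneg (cur - prev))]
  calc _ ≤ ((L + β / α + 1 / α) * (‖cur - prev‖ + ‖y - cur‖)) ^ 2 := by gcongr
    _ = (L + β / α + 1 / α) ^ 2 * (‖cur - prev‖ + ‖y - cur‖) ^ 2 := mul_pow _ _ _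
    _ ≤ (L + β / α + 1 / α) ^ 2 * (2 * (‖cur - prev‖ ^ 2 + ‖y - cur‖ ^ 2)) := by
        gcongr
        exact add_sq_le
    _ = _ := by ring

/-- Sublevel sets of a coercive function are bounded. -/
lemma CoerciveFun.isBounded_sublevel {f : EuclideanSpace ℝ (Fin n) → EReal} (hf : CoerciveFun f)
    (c : ℝ) : Bornology.IsBounded {x | f x ≤ c} := by
  rw [Bornology.isBounded_def]
  filter_upwards [EReal.tendsto_nhds_top_iff_real.1 hf c] with x hx using not_le.2 hx

/-- The local Kurdyka–Łojasiewicz inequality with exponent `1/2` in squared form. -/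
lemma HasKLExponentAt.exists_nhds_bound {f : EuclideanSpace ℝ (Fin n) → EReal}
    {a : EuclideanSpace ℝ (Fin n)} {s : ℝ} (hf : HasKLExponentAt f (1 / 2) a) (ha : f a = s) :
    ∃ M ≥ 0, ∃ U ∈ 𝓝 a, ∃ r > s, ∀ x ∈ U, ∀ q < r, f x = q →
      ∀ v ∈ limitingSubdifferential f x, q - s ≤ M * ‖v‖ ^ 2 := by
  obtain ⟨c, hc, ε, hε, ν, hν, hKL⟩ := hf
  have hsν : (s : EReal) < f a + ν := by
    rw [ha]
    simpa using EReal.add_lt_add_left_coe hν s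
  -- A real threshold, since `ν` may be `⊤`.
  obtain ⟨r, hsr, hrν⟩ := EReal.lt_iff_exists_real_btwn.1 hsν
  refine ⟨1 / c ^ 2, by positivity, Metric.closedBall a ε, Metric.closedBall_mem_nhds a hε, r,
    by exact_mod_cast hsr, fun x hx q hq hxq v hv => ?_⟩
  by_cases hqs : q ≤ s
  · exact (sub_nonpos.2 hqs).trans (by positivity)
  push Not at hqs
  have h1 := hKL x (by rwa [← dist_eq_norm]) (by rw [ha, hxq]; exact_mod_cast hqs)
    (by rw [hxq]; exact lt_trans (by exact_mod_cast hq) hrν)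
  have h2 := h1.trans (Metric.infEDist_le_edist_of_mem hv)
  rw [edist_dist, dist_zero_left, ENNReal.ofReal_le_ofReal_iff (norm_nonneg _), ha, hxq,
    ← EReal.coe_sub, EReal.toReal_coe, ← Real.sqrt_eq_rpow] at h2
  have h3 : (c * √(q - s)) ^ 2 ≤ ‖v‖ ^ 2 := by gcongr
  rw [mul_pow, Real.sq_sqrt (sub_pos.2 hqs).le] at h3
  rw [one_div_mul_eq_div, le_div_iff₀ (by positivity)]
  linarith

/-- A KL function with exponent `1/2` satisfies an error bound along a bounded sequence all of
whose cluster points lie on the limiting level and carry limiting subgradients. -/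
lemma IsKLFunctionWithExponent.exists_eventually_bound {f : EuclideanSpace ℝ (Fin n) → EReal}
    (hf : IsKLFunctionWithExponent f (1 / 2)) {y v : ℕ → EuclideanSpace ℝ (Fin n)} {q : ℕ → ℝ}
    {s : ℝ} (hbdd : Bornology.IsBounded (range y)) (hq : ∀ k, f (y k) = q k)
    (hqs : Tendsto q atTop (𝓝 s)) (hv : ∀ k, v k ∈ limitingSubdifferential f (y k))
    (hcluster : ∀ a, MapClusterPt a atTop y →
      f a = s ∧ (limitingSubdifferential f a).Nonempty) :
    ∃ M ≥ 0, ∀ᶠ k in atTop, q k - s ≤ M * ‖v k‖ ^ 2 := by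
  have hp : ∃ M ≥ 0, ∀ᶠ k in atTop, y k ∈ closure (range y) → q k - s ≤ M * ‖v k‖ ^ 2 := by
    -- Constants add under unions. Near a cluster point KL applies; near any other point the
    -- sequence is eventually absent.
    refine hbdd.isCompact_closure.induction_on
      (p := fun S => ∃ M ≥ 0, ∀ᶠ k in atTop, y k ∈ S → q k - s ≤ M * ‖v k‖ ^ 2) ?_ ?_ ?_ ?_
    · exact ⟨0, le_rfl, by simp⟩
    · rintro S T hST ⟨M, hM, hT⟩
      exact ⟨M, hM, hT.mono fun k hk hy => hk (hST hy)⟩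
    · rintro S T ⟨M, hM, hS⟩ ⟨N, hN, hT⟩
      refine ⟨M + N, add_nonneg hM hN, ?_⟩
      filter_upwards [hS, hT] with k hkS hkT hy
      have h1 := mul_nonneg hM (sq_nonneg ‖v k‖)
      have h2 := mul_nonneg hN (sq_nonneg ‖v k‖)
      rcases hy with hy | hy
      · linarith [hkS hy]
      · linarith [hkT hy]
    · intro a _
      by_cases ha : MapClusterPt a atTop y
      · obtain ⟨has, hne⟩ := hcluster a ha
        obtain ⟨M, hM, U, hU, r, hr, hbound⟩ := (hf a hne).exists_nhds_bound has
        refine ⟨U, mem_nhdsWithin_of_mem_nhds hU, M, hM, ?_⟩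
        filter_upwards [hqs.eventually_lt_const hr] with k hk hy
        exact hbound (y k) hy (q k) hk (hq k) (v k) (hv k)
      · rw [mapClusterPt_iff_frequently] at ha
        push Not at ha
        obtain ⟨U, hU, hy⟩ := ha
        refine ⟨U, mem_nhdsWithin_of_mem_nhds hU, 0, le_rfl, ?_⟩
        filter_upwards [hy] with k hk hmem using absurd hmem hk
  obtain ⟨M, hM, h⟩ := hp
  exact ⟨M, hM, h.mono fun k hk => hk (subset_closure (mem_range_self k))⟩

end Estimates

/-! ### Lyapunov function, stationarity and rate. -/

theorem mainTheorem12 {n : ℕ} (h : EuclideanSpace ℝ (Fin n) → ℝ)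
    (P : EuclideanSpace ℝ (Fin n) → EReal) (L α β : ℝ)
    (hdiff : Differentiable ℝ h) (hL : 0 < L)
    (hLip : ∀ x y, ‖∇ h x - ∇ h y‖ ≤ L * ‖x - y‖)
    (hPproper : ProperFun P) (hPclosed : LowerSemicontinuous P) (hPconvex : ConvexFun P)
    (hcoercive : CoerciveFun (fun x => (h x : EReal) + P x))
    (hKL : IsKLFunctionWithExponent (fun x => (h x : EReal) + P x) (1 / 2))
    (hβ : β ∈ Ico (0 : ℝ) 1) (hα : α ∈ Ioo (0 : ℝ) (2 * (1 - β) / L))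
    (x : ℕ → EuclideanSpace ℝ (Fin n)) (hx : IsIPianoSequence h P α β x) :
    ∃ a, IsStationaryPoint (fun x => (h x : EReal) + P x) a ∧ ConvergesRLinearly x a := by
  obtain ⟨hα0, hα1⟩ := hα
  have hβ0 := hβ.1
  -- Truncated subtraction `0 - 1 = 0` encodes `x⁻¹ = x⁰`.
  have hmin : ∀ k, IsMinOn (iPianoObjective h P α β (x (k - 1)) (x k)) univ (x (k + 1)) := by
    rintro (_ | k)
    · exact hx.1
    · exact hx.2 k
  have hsub := fun k => iPianoObjective_minimizer_subgradient hPproper hPconvex (hmin k)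
  have hfin := fun k => iPianoObjective_minimizer_ne_top hPproper (hmin k)
  set w : ℕ → EuclideanSpace ℝ (Fin n) := fun k =>
    -(∇ h (x k) - (β / α) • (x k - x (k - 1)) + (1 / α) • (x (k + 1) - x k)) with hw
  -- Indices start at `x 1`, because `P (x 0)` may be `⊤`.
  obtain ⟨p, hp⟩ : ∃ p : ℕ → ℝ, ∀ k, P (x (k + 1)) = p k :=
    ⟨fun k => (P (x (k + 1))).toReal, fun k =>
      (EReal.coe_toReal (hfin k) (hPproper.1 _)).symm⟩
  set F : ℕ → ℝ := fun k => h (x (k + 1)) + p k with hF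
  have hfF : ∀ k, (h (x (k + 1)) : EReal) + P (x (k + 1)) = F k := fun k => by
    rw [hp k, ← EReal.coe_add]
  set d : ℕ → ℝ := fun k => ‖x (k + 1) - x k‖ ^ 2 with hd
  have hd0 : ∀ k, 0 ≤ d k := fun k => sq_nonneg _
  obtain ⟨δ, hδ0, hδ⟩ : ∃ δ > 0, δ = 1 / α - L / 2 - β / α := by
    refine ⟨_, ?_, rfl⟩
    rw [lt_div_iff₀ hL] at hα1
    have : 1 / α - L / 2 - β / α = (2 * (1 - β) - α * L) / (2 * α) := by
      field_simp
      ring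
    rw [this]
    exact div_pos (by linarith) (by linarith)
  set b := β / (2 * α) with hb
  have hb0 : 0 ≤ b := by positivity
  have hstep : ∀ k, F (k + 1) ≤ F k + b * d k - (b + δ) * d (k + 1) := by
    intro k
    have h1 := iPiano_step_le hdiff hLip hα0 hβ0 (hp k) (hp (k + 1)) (hsub (k + 1))
    have h2 : 1 / α - L / 2 - β / (2 * α) = b + δ := by
      rw [hδ, hb]
      field_simp
      ring
    rwa [h2] at h1
  -- The weight `b + δ / 2` splits the gain `δ` evenly between `d k` and `d (k + 1)`.
  set H : ℕ → ℝ := fun k => F k + (b + δ / 2) * d k with hH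
  have hdec : ∀ k, δ / 2 * (d k + d (k + 1)) ≤ H k - H (k + 1) := fun k => by
    simp only [hH]
    linarith [hstep k]
  have hHanti : Antitone H := antitone_nat_of_succ_le fun k => by
    have := mul_nonneg (half_pos hδ0).le (add_nonneg (hd0 k) (hd0 (k + 1)))
    linarith [hdec k]
  have hFH : ∀ k, F k ≤ H k := fun k => by
    have := mul_nonneg (add_nonneg hb0 (half_pos hδ0).le) (hd0 k)
    simp only [hH]
    linarith
  have hbdd : Bornology.IsBounded (range fun k => x (k + 1)) := by
    refine (hcoercive.isBounded_sublevel (H 0)).subset ?_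
    rintro _ ⟨k, rfl⟩
    simp only [mem_ofPred_eq, hfF, EReal.coe_le_coe_iff]
    exact (hFH k).trans (hHanti (Nat.zero_le k))
  have hHbdd : BddBelow (range H) := by
    -- The subgradient at `x 1` gives an affine minorant of `P`, so `f` is bounded below on the
    -- compact closure.
    have hcont : Continuous fun z => h z + (p 0 + inner ℝ (w 0) (z - x 1)) := by
      have := hdiff.continuous
      fun_prop
    obtain ⟨m, hm⟩ := hbdd.isCompact_closure.bddBelow_image hcont.continuousOn
    refine ⟨m, ?_⟩
    rintro _ ⟨k, rfl⟩
    have h1 := hm (mem_image_of_mem _ (subset_closure (mem_range_self k)))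
    have h2 := hsub 0 (x (k + 1))
    rw [hp, hp, ← EReal.coe_add, EReal.coe_le_coe_iff] at h2
    refine le_trans ?_ (hFH k)
    simp only [hF]
    simp only [zero_add] at h2
    linarith
  obtain ⟨s, hHs⟩ : ∃ s, Tendsto H atTop (𝓝 s) := ⟨_, tendsto_atTop_ciInf hHanti hHbdd⟩
  have hsH : ∀ k, s ≤ H k := fun k => hHanti.le_of_tendsto hHs k
  have hdlim : Tendsto d atTop (𝓝 0) := by
    have h1 : Tendsto (fun k => 2 / δ * (H k - H (k + 1))) atTop (𝓝 0) := by
      simpa using (hHs.sub (hHs.comp (tendsto_add_atTop_nat 1))).const_mul (2 / δ)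
    refine squeeze_zero hd0 (fun k => ?_) h1
    rw [div_mul_eq_mul_div, le_div_iff₀ hδ0]
    nlinarith [hdec k, mul_nonneg hδ0.le (hd0 (k + 1))]
  have hFs : Tendsto F atTop (𝓝 s) := by
    have := hHs.sub (hdlim.const_mul (b + δ / 2))
    simpa [hH] using this
  have hdx : Tendsto (fun k => x (k + 1) - x k) atTop (𝓝 0) := by
    rw [tendsto_zero_iff_norm_tendsto_zero]
    simpa [hd, Real.sqrt_sq] using hdlim.sqrt
  have hdx' : Tendsto (fun k => x k - x (k - 1)) atTop (𝓝 0) := by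
    rw [← tendsto_add_atTop_iff_nat 1]
    simpa using hdx
  have hgrad : Continuous (∇ h) :=
    (LipschitzWith.of_dist_le_mul (K := ⟨L, hL.le⟩) fun u v => by
      rw [dist_eq_norm, dist_eq_norm]; exact hLip u v).continuous
  have hcluster : ∀ a, MapClusterPt a atTop (fun k => x (k + 1)) →
      (h a : EReal) + P a = s ∧ IsStationaryPoint (fun x => (h x : EReal) + P x) a := by
    intro a ha
    obtain ⟨φ, hφ, hlim⟩ := ha.tendsto_subseq
    have hlim' : Tendsto (fun j => x (φ j)) atTop (𝓝 a) := by
      have := hlim.sub (hdx.comp hφ.tendsto_atTop)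
      simpa [Function.comp_def] using this
    have hwlim : Tendsto (fun j => w (φ j)) atTop (𝓝 (-∇ h a)) := by
      have h1 := (((hgrad.tendsto a).comp hlim').sub
        ((hdx'.comp hφ.tendsto_atTop).const_smul (β / α))).add
        ((hdx.comp hφ.tendsto_atTop).const_smul (1 / α))
      rw [smul_zero, smul_zero, sub_zero, add_zero] at h1
      exact h1.neg
    have hplim : Tendsto (fun j => p (φ j)) atTop (𝓝 (s - h a)) := by
      have := (hFs.comp hφ.tendsto_atTop).sub ((hdiff.continuous.tendsto a).comp hlim)
      simpa [hF, Function.comp_def] using this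
    obtain ⟨hPa, hsa⟩ := IsConvexSubgradient.of_tendsto hPclosed (fun j => hp (φ j))
      (fun j => hsub (φ j)) hlim hwlim hplim
    refine ⟨by rw [hPa, ← EReal.coe_add, add_sub_cancel], ?_⟩
    have := hsa.mem_regularSubdifferential (hdiff a) hPproper.1 (hPa ▸ EReal.coe_ne_top _)
    rw [add_neg_cancel] at this
    exact regularSubdifferential_subset_limitingSubdifferential _ _ this
  obtain ⟨M, hM, hbound⟩ := hKL.exists_eventually_bound hbdd hfF hFs
    (fun k => regularSubdifferential_subset_limitingSubdifferential _ _
      ((hsub k).mem_regularSubdifferential (hdiff _) hPproper.1 (hfin k)))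
    (fun a ha => ⟨(hcluster a ha).1, 0, (hcluster a ha).2⟩)
  set K := 2 * (L + β / α + 1 / α) ^ 2 with hK
  have hK0 : 0 ≤ K := by positivity
  obtain ⟨a, hxa, C, hC, r, hr0, hr1, hrate⟩ := exists_geometric_rate
    (y := fun k => x (k + 1)) (e := fun k => H k - s) (half_pos hδ0)
    (M := (M * K + b + δ / 2) * (2 / δ)) (by positivity) (fun k => sub_nonneg.2 (hsH k))
    (fun k => by
      have := mul_nonneg (half_pos hδ0).le (hd0 k)
      have h1 := hdec k
      rw [mul_add] at h1
      change δ / 2 * d (k + 1) ≤ _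
      linarith)
    (by
      filter_upwards [(tendsto_add_atTop_nat 1).eventually hbound] with k hk
      have h1 : M * _ ≤ M * (K * (d k + d (k + 1))) := mul_le_mul_of_nonneg_left
        (iPiano_subgradient_norm_sq_le hL.le hLip hα0 hβ0 (x k) (x (k + 1)) (x (k + 2))) hM
      have h2 : F (k + 1) - s ≤ M * (K * (d k + d (k + 1))) := hk.trans h1
      have h3 : d k + d (k + 1) ≤ 2 / δ * (H k - H (k + 1)) := by
        rw [div_mul_eq_mul_div, le_div_iff₀ hδ0]
        linarith [hdec k]
      have h4 := mul_nonneg (add_nonneg hb0 (half_pos hδ0).le) (hd0 k)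
      calc H (k + 1) - s ≤ (M * K + b + δ / 2) * (d k + d (k + 1)) := by
            simp only [hH]
            linarith
        _ ≤ (M * K + b + δ / 2) * (2 / δ * (H k - H (k + 1))) := by gcongr
        _ = _ := by ring)
  refine ⟨a, (hcluster a hxa.mapClusterPt).2, (tendsto_add_atTop_iff_nat 1).1 hxa, ?_⟩
  refine limsup_rpow_inv_lt_one (C := C / r) (fun k => norm_nonneg _) hr0 hr1 (by positivity) ?_
  rw [← map_add_atTop_eq_nat 1, eventually_map]
  filter_upwards [hrate] with k hk
  calc _ ≤ C * r ^ k := hk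
    _ = C / r * r ^ (k + 1) := by rw [pow_succ]; field_simp
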